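/- For positive integers $n,m$, a real number $p\in(1,\infty)$ and a real number $\varepsilon>0$, let $L(n,m,p,\varepsilon)$ be the layer $\mathbb{R}^n\times[0,\varepsilon]^m\subset\mathbb{R}^{n+m}$ with the metric induced by the $\ell_p$-norm of $\mathbb{R}^{n+m}$. The unit distance graph of a metric space is the graph whose vertices are the points of the space and in which two vertices are joined by an edge if and only if their distance is exactly $1$. Theorem. Let $n\ge 2$ and $m\ge 1$ be integers, let $p\in(1,\infty)$, and let $\varepsilon_1,\varepsilon_2\in(0,\infty)$. Then the unit distance graphs of the layers $L(n,m,p,\varepsilon_1)$ and $L(n,m,p,\varepsilon_2)$ are isomorphic if and only if $\varepsilon_1=\varepsilon_2$. -/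

import Mathlib

open scoped ENNReal

/-- The unit distance graph of a set `V` in a metric space: its vertices are the points of `V`,
and two vertices are joined by an edge if and only if their distance is `1`. -/
def unitDistanceGraph {X : Type*} [MetricSpace X] (V : Set X) : SimpleGraph V where
  Adj x y := dist (x : X) (y : X) = 1
  symm := ⟨fun x y h => by rw [dist_comm]; exact h⟩
  loopless := ⟨fun x h => by simp at h⟩

/-- The layer `ℝⁿ × [0, ε]ᵐ`, as a subset of `ℝⁿ⁺ᵐ` with the `ℓ_p` metric. The coordinates of
`ℝⁿ⁺ᵐ` are indexed by `Fin n ⊕ Fin m`: the first `n` are unrestricted, the last `m` lie in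
`[0, ε]`. -/
def layer (n m : ℕ) (p : ℝ≥0∞) (ε : ℝ) : Set (PiLp p (fun _ : Fin n ⊕ Fin m => ℝ)) :=
  {x | ∀ j : Fin m, x (Sum.inr j) ∈ Set.Icc 0 ε}

/-!
Let `F` be an isomorphism between the unit distance graphs of two layers, and call a vector
horizontal if its last `m` coordinates vanish.

Since `n ≥ 2`, two points of a layer at distance at most `2` have a common neighbour in the unit
distance graph (`exists_mem_norm_add_eq_one_norm_sub_eq_one`), and since the norm is strictly convex
this neighbour is unique exactly when the distance is `2`. So `F` preserves distance `2`
(`IsUnitDistanceBijOn.dist_eq_two`) and hence arithmetic progressions with unit step. An infinite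
progression in a layer is horizontal, and progressions with the same step through adjacent points
stay at distance `1` from each other, which forces their images to have the same step. Therefore
`F (x + h) = F x + A h` for all horizontal `h`, where `A` does not depend on `x`; being additive and
bounded near `0` and preserving the unit sphere, `A` is a linear isometry
(`IsUnitDistanceBijOn.exists_linearIsometry`).

The horizontal translates of `x` adjacent to `y` form a sphere whose radius determines the vertical
distance of `x` and `y`, as long as the latter is less than `1`. As `A` carries spheres to spheres,
such vertical distances are preserved (`IsUnitDistanceBijOn.norm_map_sub_eq`). Chaining along
segments, `F` does not increase any vertical distance, and neither does its inverse, so the vertical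
diameters of the two layers agree. They are `ε₁` and `ε₂` times the same positive constant.
-/

open Set Filter Topology Metric

/-! ### Unit vectors symmetric about a short vector -/

section Slab

variable {E : Type*} [NormedAddCommGroup E] [NormedSpace ℝ E]

/-- A vector of norm at most `1` is half the sum of two unit vectors which differ from it by a
vector of any prescribed subspace `H` of dimension at least `2`. The boundary of the symmetric
convex body `{v ∈ H | ‖h + v‖ < 1, ‖h - v‖ < 1}` is connected, so the odd function
`‖h + v‖ - ‖h - v‖` has a zero on it. -/
theorem exists_mem_norm_add_eq_one_norm_sub_eq_one {H : Submodule ℝ E} [FiniteDimensional ℝ H]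
    (hH : 1 < Module.rank ℝ H) {h : E} (hh : ‖h‖ ≤ 1) :
    ∃ v ∈ H, ‖h + v‖ = 1 ∧ ‖h - v‖ = 1 := by
  rcases hh.eq_or_lt with hh | hh
  · exact ⟨0, H.zero_mem, by simpa using hh, by simpa using hh⟩
  set K : Set H := {v | ‖h + v‖ < 1} ∩ {v | ‖h - v‖ < 1} with hK
  have hopen : IsOpen K :=
    (isOpen_lt (by fun_prop) continuous_const).inter (isOpen_lt (by fun_prop) continuous_const)
  have h0 : (0 : H) ∈ K := by simp [hK, hh]
  have hconv : Convex ℝ K := by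
    have hadd : Convex ℝ {v : H | ‖h + v‖ < 1} := by
      have hset : {v : H | ‖h + v‖ < 1} = H.subtype ⁻¹' ball (-h) 1 := by
        ext v
        simp [dist_eq_norm, add_comm]
      rw [hset]
      exact (convex_ball (-h) (1 : ℝ)).linear_preimage H.subtype
    have hsub : Convex ℝ {v : H | ‖h - v‖ < 1} := by
      have hset : {v : H | ‖h - v‖ < 1} = H.subtype ⁻¹' ball h 1 := by
        ext v
        simp [dist_eq_norm, norm_sub_rev]
      rw [hset]
      exact (convex_ball h (1 : ℝ)).linear_preimage H.subtype
    exact hadd.inter hsub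
  have hbdd : Bornology.IsBounded K := by
    refine isBounded_iff_forall_norm_le.2 ⟨2, fun v hv => ?_⟩
    have h1 : ‖(v : E)‖ ≤ ‖h + v‖ + ‖h‖ := by
      simpa using norm_sub_le (h + (v : E)) h
    have h2 : ‖h + (v : E)‖ < 1 := hv.1
    rw [Submodule.coe_norm]
    linarith
  obtain ⟨e, -, -, he⟩ := exists_homeomorph_image_interior_closure_frontier_eq_unitBall hconv
    ⟨0, by rwa [hopen.interior_eq]⟩ hbdd
  have hfr : frontier K = e.symm '' sphere 0 1 := by
    rw [← he, ← image_comp]; simp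
  have hpre : IsPreconnected (frontier K) := by
    rw [hfr]
    exact (isPreconnected_sphere hH 0 1).image _ e.symm.continuous.continuousOn
  have hne : (frontier K).Nonempty := by
    rw [hfr]
    have : Nontrivial H := rank_pos_iff_nontrivial.1 (zero_lt_one.trans hH)
    exact (NormedSpace.sphere_nonempty.2 zero_le_one).image _
  have hcl : ∀ v ∈ closure K, ‖h + (v : E)‖ ≤ 1 ∧ ‖h - (v : E)‖ ≤ 1 := by
    have : closure K ⊆ {v : H | ‖h + (v : E)‖ ≤ 1} ∩ {v : H | ‖h - (v : E)‖ ≤ 1} :=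
      closure_minimal (inter_subset_inter (fun v (hv : ‖h + (v : E)‖ < 1) => hv.le)
        (fun v (hv : ‖h - (v : E)‖ < 1) => hv.le))
        ((isClosed_le (by fun_prop) continuous_const).inter
          (isClosed_le (by fun_prop) continuous_const))
    exact this
  have hneg : ∀ v ∈ frontier K, -v ∈ frontier K := by
    have hKneg : (Homeomorph.neg H) ⁻¹' K = K := by
      ext v; simp [hK, and_comm, sub_eq_add_neg]
    intro v hv
    have := (Homeomorph.neg H).preimage_frontier K
    rw [hKneg] at this
    rw [← this] at hv
    simpa using hv
  obtain ⟨v₀, hv₀⟩ := hne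
  set g : H → ℝ := fun v => ‖h + (v : E)‖ - ‖h - (v : E)‖ with hg
  have hgneg : ∀ v, g (-v) = -g v := by intro v; simp [hg, sub_eq_add_neg]
  have hgc : ContinuousOn g (frontier K) := by
    apply Continuous.continuousOn; fun_prop
  have hzero : ∃ v ∈ frontier K, g v = 0 := by
    rcases le_total (g v₀) 0 with h' | h'
    · exact hpre.intermediate_value hv₀ (hneg _ hv₀) hgc ⟨h', by rw [hgneg]; linarith⟩
    · exact hpre.intermediate_value (hneg _ hv₀) hv₀ hgc ⟨by rw [hgneg]; linarith, h'⟩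
  obtain ⟨v, hv, hgv⟩ := hzero
  rw [hopen.frontier_eq] at hv
  have heq : ‖h + (v : E)‖ = ‖h - (v : E)‖ := sub_eq_zero.1 hgv
  have hle := hcl v hv.1
  have h1 : ‖h + (v : E)‖ = 1 := by
    by_contra hne
    have hlt := lt_of_le_of_ne hle.1 hne
    exact hv.2 ⟨hlt, show ‖h - (v : E)‖ < 1 by rwa [← heq]⟩
  exact ⟨v, v.2, h1, heq ▸ h1⟩

/-! ### Chaining along segments -/

/-- A local Lipschitz estimate with respect to a linear seminorm propagates along the segments of
a convex set. For `L = 0` this says that locally constant functions are constant. -/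
theorem Convex.dist_le_norm_of_forall_dist_le {S : Set E} (hS : Convex ℝ S) {M F : Type*}
    [PseudoMetricSpace M] [NormedAddCommGroup F] [NormedSpace ℝ F] (L : E →ₗ[ℝ] F) (g : E → M)
    {δ : ℝ} (hδ : 0 < δ)
    (hloc : ∀ x ∈ S, ∀ y ∈ S, dist x y < δ → dist (g x) (g y) ≤ ‖L (x - y)‖)
    {x y : E} (hx : x ∈ S) (hy : y ∈ S) : dist (g x) (g y) ≤ ‖L (x - y)‖ := by
  obtain ⟨N, hN⟩ := exists_nat_gt (dist x y / δ)
  have hN0 : (0 : ℝ) < N := lt_of_le_of_lt (by positivity) hN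
  set z : ℕ → E := fun i => AffineMap.lineMap x y ((i : ℝ) / N) with hz
  have hzS : ∀ i ≤ N, z i ∈ S := fun i hi =>
    hS.lineMap_mem hx hy ⟨by positivity, by rw [div_le_one hN0]; exact_mod_cast hi⟩
  have hdiff : ∀ i, z i - z (i + 1) = (N : ℝ)⁻¹ • (x - y) := by
    intro i
    simp only [hz, AffineMap.lineMap_apply, vsub_eq_sub, vadd_eq_add]
    push_cast
    module
  have hstep : ∀ i < N, dist (g (z i)) (g (z (i + 1))) ≤ (N : ℝ)⁻¹ * ‖L (x - y)‖ := by
    intro i hi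
    refine (hloc _ (hzS i hi.le) _ (hzS (i + 1) hi) ?_).trans ?_
    · rw [dist_eq_norm, hdiff, norm_smul, norm_inv, RCLike.norm_natCast, ← dist_eq_norm,
        inv_mul_lt_iff₀ hN0]
      rwa [div_lt_iff₀ hδ] at hN
    · rw [hdiff, map_smul, norm_smul, norm_inv, RCLike.norm_natCast]
  have hsum := dist_le_range_sum_of_dist_le (f := fun i => g (z i)) N (fun {i} hi => hstep i hi)
  have hz0 : z 0 = x := by simp [hz]
  have hzN : z N = y := by simp [hz, hN0.ne']
  rw [hz0, hzN] at hsum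
  refine hsum.trans_eq ?_
  rw [Finset.sum_const, Finset.card_range, nsmul_eq_mul]
  field_simp

/-! ### Two facts on norms -/

theorem eq_zero_of_forall_norm_add_smul_le {a b : E} {C : ℝ}
    (h : ∀ k : ℕ, ‖a + (k : ℝ) • b‖ ≤ C) : b = 0 := by
  by_contra hb
  have hb' : 0 < ‖b‖ := norm_pos_iff.2 hb
  obtain ⟨k, hk⟩ := exists_nat_gt ((C + ‖a‖) / ‖b‖)
  rw [div_lt_iff₀ hb'] at hk
  have h1 : ‖(k : ℝ) • b‖ ≤ ‖a + (k : ℝ) • b‖ + ‖a‖ := by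
    simpa using norm_sub_le (a + (k : ℝ) • b) a
  rw [norm_smul, RCLike.norm_natCast] at h1
  linarith [h k]

/-- A sphere of positive radius is contained in no sphere with a different center, because two of
its points lie at different distances from that center. -/
theorem eq_zero_of_norm_add_eq_norm_sub {V : Type*} [NormedAddCommGroup V] [NormedSpace ℝ V]
    {c : V} {r : ℝ} (hr : 0 < r) (h : ∀ v : V, ‖v‖ = r → ‖v + c‖ = ‖-v + c‖) : c = 0 := by
  by_contra hc
  have hc' : 0 < ‖c‖ := norm_pos_iff.2 hc
  have h1 := h ((r / ‖c‖) • c) (by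
    rw [norm_smul, Real.norm_of_nonneg (by positivity), div_mul_cancel₀ _ hc'.ne'])
  have e1 : (r / ‖c‖) • c + c = (r / ‖c‖ + 1) • c := by module
  have e2 : -((r / ‖c‖) • c) + c = (1 - r / ‖c‖) • c := by module
  rw [e1, e2, norm_smul, norm_smul] at h1
  have h2 := mul_right_cancel₀ hc'.ne' h1
  have h3 : 0 < r / ‖c‖ := by positivity
  rw [Real.norm_of_nonneg (by positivity), Real.norm_eq_abs] at h2
  rcases abs_cases (1 - r / ‖c‖) with ⟨h4, -⟩ | ⟨h4, -⟩ <;> linarith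

/-! ### Slabs and unit distance bijections -/

/-- A slab with respect to a linear map `P`: a convex set which is invariant under translation by
the vectors of `ker P`, the horizontal vectors, and whose image under `P` is bounded. A layer is a
slab for the projection `P` onto its last `m` coordinates. -/
structure IsSlab (P : E →ₗ[ℝ] E) (S : Set E) : Prop where
  convex : Convex ℝ S
  add_mem : ∀ x ∈ S, ∀ h ∈ LinearMap.ker P, x + h ∈ S
  bounded : ∃ C, ∀ x ∈ S, ‖P x‖ ≤ C

/-- `F` restricts to an isomorphism between the unit distance graphs of `S` and `T`. The values
of `F` outside `S` play no role. -/
structure IsUnitDistanceBijOn (F : E → E) (S T : Set E) : Prop where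
  bijOn : BijOn F S T
  dist_eq_one_iff : ∀ x ∈ S, ∀ y ∈ S, dist (F x) (F y) = 1 ↔ dist x y = 1

variable {P : E →ₗ[ℝ] E} {S T : Set E} {F : E → E}

/-- Two points of a slab at distance at most `2` have common neighbours in the unit distance
graph, placed symmetrically about their midpoint. -/
theorem IsSlab.exists_common_neighbors (hS : IsSlab P S) [FiniteDimensional ℝ (LinearMap.ker P)]
    (hP : 1 < Module.rank ℝ (LinearMap.ker P)) {x y : E} (hx : x ∈ S) (hy : y ∈ S)
    (hxy : dist x y ≤ 2) :
    ∃ v ∈ LinearMap.ker P, (midpoint ℝ x y + v ∈ S ∧ dist x (midpoint ℝ x y + v) = 1 ∧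
      dist (midpoint ℝ x y + v) y = 1) ∧ (midpoint ℝ x y - v ∈ S ∧
      dist x (midpoint ℝ x y - v) = 1 ∧ dist (midpoint ℝ x y - v) y = 1) := by
  have hmid : midpoint ℝ x y = (1 / 2 : ℝ) • (x + y) := by
    rw [midpoint_eq_smul_add]; norm_num
  have hh : ‖(1 / 2 : ℝ) • (x - y)‖ ≤ 1 := by
    rw [norm_smul, ← dist_eq_norm]; norm_num; linarith
  obtain ⟨v, hv, h1, h2⟩ := exists_mem_norm_add_eq_one_norm_sub_eq_one hP hh
  have hm : midpoint ℝ x y ∈ S := hS.convex.midpoint_mem hx hy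
  refine ⟨v, hv, ⟨hS.add_mem _ hm _ hv, ?_, ?_⟩, ?_, ?_, ?_⟩
  · rw [dist_eq_norm, ← h2, hmid]; congr 1; module
  · rw [dist_eq_norm, ← h1, hmid]; congr 1; module
  · rw [sub_eq_add_neg]; exact hS.add_mem _ hm _ (neg_mem hv)
  · rw [dist_eq_norm, ← h1, hmid]; congr 1; module
  · rw [dist_eq_norm, ← h2, hmid]; congr 1; module

variable [StrictConvexSpace ℝ E] [FiniteDimensional ℝ (LinearMap.ker P)]

/-- By strict convexity, points at distance `2` are those with exactly one common neighbour, so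
distance `2` is preserved. -/
theorem IsUnitDistanceBijOn.dist_eq_two (hF : IsUnitDistanceBijOn F S T) (hS : IsSlab P S)
    (hT : IsSlab P T) (hP : 1 < Module.rank ℝ (LinearMap.ker P)) {x y : E} (hx : x ∈ S)
    (hy : y ∈ S) (hxy : dist x y = 2) : dist (F x) (F y) = 2 := by
  obtain ⟨v, -, ⟨hzS, hxz, hzy⟩, -⟩ := hS.exists_common_neighbors hP hx hy hxy.le
  set z := midpoint ℝ x y + v
  have h1 := (hF.dist_eq_one_iff x hx z hzS).2 hxz
  have h2 := (hF.dist_eq_one_iff z hzS y hy).2 hzy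
  have hle : dist (F x) (F y) ≤ 2 := by
    linarith [dist_triangle (F x) (F z) (F y)]
  refine hle.eq_of_not_lt fun hlt => ?_
  obtain ⟨w, -, ⟨haT, hxa, hay⟩, hbT, hxb, hby⟩ :=
    hT.exists_common_neighbors hP (hF.bijOn.mapsTo hx) (hF.bijOn.mapsTo hy) hle
  -- Every common neighbour of `F x` and `F y` comes from the midpoint of `x` and `y`.
  have huniq : ∀ c ∈ T, dist (F x) c = 1 → dist c (F y) = 1 → c = F (midpoint ℝ x y) := by
    intro c hc hxc hcy
    obtain ⟨c, hcS, rfl⟩ := hF.bijOn.surjOn hc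
    rw [hF.dist_eq_one_iff x hx c hcS] at hxc
    rw [hF.dist_eq_one_iff c hcS y hy] at hcy
    rw [eq_midpoint_of_dist_eq_half (x := x) (y := c) (z := y) (by rw [hxc, hxy]; norm_num)
      (by rw [hcy, hxy]; norm_num)]
  have hab := (huniq _ haT hxa hay).trans (huniq _ hbT hxb hby).symm
  have hw : w = 0 := by
    have h3 : (2 : ℝ) • w = (midpoint ℝ (F x) (F y) + w) - (midpoint ℝ (F x) (F y) - w) := by module
    rw [hab, sub_self] at h3
    simpa using h3
  rw [hw, add_zero, dist_left_midpoint] at hxa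
  norm_num at hxa
  linarith

/-- Horizontal arithmetic progressions with unit step are mapped to arithmetic progressions: the
middle one of three consecutive terms is the midpoint of the other two. -/
theorem IsUnitDistanceBijOn.map_add_smul (hF : IsUnitDistanceBijOn F S T) (hS : IsSlab P S)
    (hT : IsSlab P T) (hP : 1 < Module.rank ℝ (LinearMap.ker P)) {x u : E} (hx : x ∈ S)
    (hu : u ∈ LinearMap.ker P) (hu1 : ‖u‖ = 1) (k : ℕ) :
    F (x + (k : ℝ) • u) = F x + (k : ℝ) • (F (x + u) - F x) := by
  have hmem : ∀ k : ℕ, x + (k : ℝ) • u ∈ S := fun k =>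
    hS.add_mem _ hx _ (Submodule.smul_mem _ _ hu)
  have hstep : ∀ k : ℕ, dist (F (x + (k : ℝ) • u)) (F (x + ((k + 1 : ℕ) : ℝ) • u)) = 1 := by
    intro k
    rw [hF.dist_eq_one_iff _ (hmem k) _ (hmem (k + 1)), dist_eq_norm, ← norm_neg, ← hu1]
    congr 1; push_cast; module
  have hstep2 : ∀ k : ℕ, dist (F (x + (k : ℝ) • u)) (F (x + ((k + 2 : ℕ) : ℝ) • u)) = 2 := by
    intro k
    refine hF.dist_eq_two hS hT hP (hmem k) (hmem (k + 2)) ?_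
    have : x + (k : ℝ) • u - (x + ((k + 2 : ℕ) : ℝ) • u) = (-2 : ℝ) • u := by
      push_cast; module
    rw [dist_eq_norm, this, norm_smul, hu1]; norm_num
  have hrec : ∀ k : ℕ, F (x + ((k + 2 : ℕ) : ℝ) • u) =
      (2 : ℝ) • F (x + ((k + 1 : ℕ) : ℝ) • u) - F (x + (k : ℝ) • u) := by
    intro k
    have hm := eq_midpoint_of_dist_eq_half (x := F (x + (k : ℝ) • u))
      (y := F (x + ((k + 1 : ℕ) : ℝ) • u)) (z := F (x + ((k + 2 : ℕ) : ℝ) • u))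
      (by rw [hstep, hstep2]; norm_num) (by rw [hstep (k + 1), hstep2]; norm_num)
    rw [hm, midpoint_eq_smul_add, smul_smul]
    norm_num
  induction k using Nat.twoStepInduction with
  | zero => simp
  | one => simp
  | more k h0 h1 =>
    rw [hrec, h0, h1]; push_cast; module

/-! ### Action on horizontal translations -/

/-- A horizontal unit translation is carried to a horizontal unit translation. The image of a
horizontal arithmetic progression with unit step is again one; its step is horizontal because the
slab is vertically bounded, and adjacent points have the same step because the two progressions
stay at distance `1` from each other. -/
theorem IsUnitDistanceBijOn.exists_map_add_eq_of_norm_eq_one (hF : IsUnitDistanceBijOn F S T)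
    (hS : IsSlab P S) (hT : IsSlab P T) (hP : 1 < Module.rank ℝ (LinearMap.ker P))
    (hne : S.Nonempty) {u : E} (hu : u ∈ LinearMap.ker P) (hu1 : ‖u‖ = 1) :
    ∃ c ∈ LinearMap.ker P, ‖c‖ = 1 ∧ ∀ x ∈ S, F (x + u) = F x + c := by
  obtain ⟨x₀, hx₀⟩ := hne
  have hadj : ∀ x ∈ S, ∀ y ∈ S, dist x y = 1 → F (x + u) - F x = F (y + u) - F y := by
    intro x hx y hy hxy
    refine sub_eq_zero.1 (eq_zero_of_forall_norm_add_smul_le (a := F x - F y) (C := 1) fun k => ?_)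
    have h1 : dist (F (x + (k : ℝ) • u)) (F (y + (k : ℝ) • u)) = 1 := by
      rw [hF.dist_eq_one_iff _ (hS.add_mem _ hx _ (Submodule.smul_mem _ _ hu)) _
        (hS.add_mem _ hy _ (Submodule.smul_mem _ _ hu)), dist_add_right, hxy]
    rw [hF.map_add_smul hS hT hP hx hu hu1, hF.map_add_smul hS hT hP hy hu hu1,
      dist_eq_norm] at h1
    rw [← h1]
    apply le_of_eq
    congr 1
    module
  have hconst : ∀ x ∈ S, F (x + u) - F x = F (x₀ + u) - F x₀ := by
    intro x hx
    have := hS.convex.dist_le_norm_of_forall_dist_le (0 : E →ₗ[ℝ] E)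
      (fun x => F (x + u) - F x) two_pos ?_ hx hx₀
    · rw [LinearMap.zero_apply, norm_zero] at this
      exact dist_le_zero.1 this
    · intro x hx y hy hxy
      obtain ⟨v, -, ⟨hz, hxz, hzy⟩, -⟩ := hS.exists_common_neighbors hP hx hy hxy.le
      simp [(hadj _ hx _ hz hxz).trans (hadj _ hz _ hy hzy)]
  refine ⟨F (x₀ + u) - F x₀, ?_, ?_, fun x hx => ?_⟩
  · obtain ⟨C, hC⟩ := hT.bounded
    refine LinearMap.mem_ker.2
      (eq_zero_of_forall_norm_add_smul_le (a := P (F x₀)) (C := C) fun k => ?_)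
    rw [← map_smul, ← map_add, ← hF.map_add_smul hS hT hP hx₀ hu hu1]
    exact hC _ (hF.bijOn.mapsTo (hS.add_mem _ hx₀ _ (Submodule.smul_mem _ _ hu)))
  · rw [← dist_eq_norm, hF.dist_eq_one_iff _ (hS.add_mem _ hx₀ _ hu) _ hx₀, dist_eq_norm,
      add_sub_cancel_left, hu1]
  · rw [← hconst x hx]; abel

/-- A horizontal translation of norm at most `2` is the composition of two horizontal unit
translations. -/
theorem IsUnitDistanceBijOn.exists_map_add_eq_of_norm_le_two (hF : IsUnitDistanceBijOn F S T)
    (hS : IsSlab P S) (hT : IsSlab P T) (hP : 1 < Module.rank ℝ (LinearMap.ker P))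
    (hne : S.Nonempty) {h : E} (hh : h ∈ LinearMap.ker P) (hh2 : ‖h‖ ≤ 2) :
    ∃ c ∈ LinearMap.ker P, ‖c‖ ≤ 2 ∧ ∀ x ∈ S, F (x + h) = F x + c := by
  have hh1 : ‖(1 / 2 : ℝ) • h‖ ≤ 1 := by
    rw [norm_smul]; norm_num; linarith
  obtain ⟨v, hv, h1, h2⟩ := exists_mem_norm_add_eq_one_norm_sub_eq_one hP hh1
  have hm := Submodule.smul_mem (LinearMap.ker P) (1 / 2 : ℝ) hh
  obtain ⟨c, hc, hc1, hcF⟩ :=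
    hF.exists_map_add_eq_of_norm_eq_one hS hT hP hne (add_mem hm hv) h1
  obtain ⟨d, hd, hd1, hdF⟩ :=
    hF.exists_map_add_eq_of_norm_eq_one hS hT hP hne (sub_mem hm hv) h2
  refine ⟨c + d, add_mem hc hd, (norm_add_le _ _).trans (by linarith), fun x hx => ?_⟩
  have : x + h = x + ((1 / 2 : ℝ) • h + v) + ((1 / 2 : ℝ) • h - v) := by module
  rw [this, hdF _ (hS.add_mem _ hx _ (add_mem hm hv)), hcF _ hx, add_assoc]

theorem IsUnitDistanceBijOn.exists_map_add_eq (hF : IsUnitDistanceBijOn F S T)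
    (hS : IsSlab P S) (hT : IsSlab P T) (hP : 1 < Module.rank ℝ (LinearMap.ker P))
    (hne : S.Nonempty) (h : LinearMap.ker P) :
    ∃ c : LinearMap.ker P, ∀ x ∈ S, F (x + h) = F x + c := by
  obtain ⟨N, hN⟩ := exists_nat_gt ‖h‖
  have hN0 : (0 : ℝ) < N := (norm_nonneg h).trans_lt hN
  have hle : ‖(N : ℝ)⁻¹ • (h : E)‖ ≤ 2 := by
    rw [norm_smul, norm_inv, RCLike.norm_natCast, inv_mul_le_iff₀ hN0, ← Submodule.coe_norm]
    linarith
  have hmem := Submodule.smul_mem (LinearMap.ker P) (N : ℝ)⁻¹ h.2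
  obtain ⟨c, hc, -, hcF⟩ := hF.exists_map_add_eq_of_norm_le_two hS hT hP hne hmem hle
  have key : ∀ k : ℕ, ∀ x ∈ S, F (x + (k : ℝ) • (N : ℝ)⁻¹ • (h : E)) = F x + (k : ℝ) • c := by
    intro k x hx
    induction k with
    | zero => simp
    | succ k ih =>
      have : x + ((k + 1 : ℕ) : ℝ) • (N : ℝ)⁻¹ • (h : E) =
          x + (k : ℝ) • (N : ℝ)⁻¹ • (h : E) + (N : ℝ)⁻¹ • (h : E) := by push_cast; module
      rw [this, hcF _ (hS.add_mem _ hx _ (Submodule.smul_mem _ _ hmem)), ih]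
      push_cast; module
  refine ⟨⟨(N : ℝ) • c, Submodule.smul_mem _ _ hc⟩, fun x hx => ?_⟩
  have := key N x hx
  rwa [smul_inv_smul₀ hN0.ne'] at this

/-- A unit distance isomorphism of slabs acts on horizontal translations through a linear isometry
of the space of horizontal vectors: the action is additive, and it is continuous because it is
bounded on the ball of radius `2`. -/
theorem IsUnitDistanceBijOn.exists_linearIsometry (hF : IsUnitDistanceBijOn F S T)
    (hS : IsSlab P S) (hT : IsSlab P T) (hP : 1 < Module.rank ℝ (LinearMap.ker P))
    (hne : S.Nonempty) :
    ∃ A : LinearMap.ker P →ₗᵢ[ℝ] LinearMap.ker P,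
      ∀ x ∈ S, ∀ h : LinearMap.ker P, F (x + h) = F x + A h := by
  choose A hA using hF.exists_map_add_eq hS hT hP hne
  obtain ⟨x₀, hx₀⟩ := hne
  have huniq : ∀ (h : LinearMap.ker P) (c : E), (∀ x ∈ S, F (x + h) = F x + c) → (A h : E) = c :=
    fun h c hc => add_left_cancel ((hA h x₀ hx₀).symm.trans (hc x₀ hx₀))
  let A' : LinearMap.ker P →+ LinearMap.ker P := AddMonoidHom.mk' A fun h k => by
    refine Subtype.ext (huniq _ _ fun x hx => ?_)
    have := hA k (x + h) (hS.add_mem _ hx _ h.2)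
    rw [hA h x hx] at this
    simpa [add_assoc] using this
  have hcont : Continuous A' := by
    refine A'.continuous_of_isBounded_nhds_zero (closedBall_mem_nhds 0 two_pos)
      (isBounded_iff_forall_norm_le.2 ⟨2, ?_⟩)
    rintro _ ⟨h, hh, rfl⟩
    rw [mem_closedBall_zero_iff] at hh
    obtain ⟨c, -, hc2, hcF⟩ :=
      hF.exists_map_add_eq_of_norm_le_two hS hT hP ⟨x₀, hx₀⟩ h.2 hh
    change ‖(A h : E)‖ ≤ 2
    rwa [huniq h c hcF]
  let B : LinearMap.ker P →L[ℝ] LinearMap.ker P := A'.toRealLinearMap hcont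
  have hB1 : ∀ u : LinearMap.ker P, ‖u‖ = 1 → ‖B u‖ = 1 := by
    intro u hu
    obtain ⟨c, -, hc1, hcF⟩ :=
      hF.exists_map_add_eq_of_norm_eq_one hS hT hP ⟨x₀, hx₀⟩ u.2 hu
    change ‖(A u : E)‖ = 1
    rw [huniq u c hcF, hc1]
  refine ⟨⟨B, fun h => ?_⟩, fun x hx h => hA h x hx⟩
  rcases eq_or_ne h 0 with rfl | hh
  · simp
  · have h0 : ‖h‖ ≠ 0 := norm_ne_zero_iff.2 hh
    have h1 := hB1 (‖h‖⁻¹ • h) (by rw [norm_smul, norm_inv, norm_norm, inv_mul_cancel₀ h0])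
    rw [map_smul, norm_smul, norm_inv, norm_norm, inv_mul_eq_one₀ h0] at h1
    exact h1.symm

/-! ### Vertical distances -/

/-- Vertical distances smaller than `1` are preserved. If `x` and `y` have vertical distance
`δ < 1`, then the horizontal translates of `x` adjacent to `y` form a sphere with center above or
below `y`, of radius `r > 0` with `r ^ q = 1 - δ ^ q`. Its image has the same radius and lies in
the corresponding sphere around `F y`, so the two spheres have the same center and radius. -/
theorem IsUnitDistanceBijOn.norm_map_sub_eq (hF : IsUnitDistanceBijOn F S T)
    (hS : IsSlab P S) (hT : IsSlab P T) (hP : 1 < Module.rank ℝ (LinearMap.ker P))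
    (hPP : ∀ x, P (P x) = P x) {q : ℝ} (hq : 0 < q)
    (hnorm : ∀ x, ‖x‖ ^ q = ‖x - P x‖ ^ q + ‖P x‖ ^ q) {x y : E} (hx : x ∈ S) (hy : y ∈ S)
    (hxy : ‖P (x - y)‖ < 1) : ‖P (F x - F y)‖ = ‖P (x - y)‖ := by
  obtain ⟨A, hA⟩ := hF.exists_linearIsometry hS hT hP ⟨x, hx⟩
  have hker : ∀ z, z - P z ∈ LinearMap.ker P := fun z => by
    rw [LinearMap.mem_ker, map_sub, hPP, sub_self]
  have hinj : ∀ {a b : ℝ}, 0 ≤ a → 0 ≤ b → a ^ q = b ^ q → a = b := fun ha hb hab =>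
    Real.rpow_left_injOn hq.ne' ha hb hab
  have hδ : ‖P (x - y)‖ ^ q < 1 := Real.rpow_lt_one (norm_nonneg _) hxy hq
  set r : ℝ := (1 - ‖P (x - y)‖ ^ q) ^ q⁻¹ with hr
  have hr0 : 0 < r := Real.rpow_pos_of_pos (by linarith) _
  have hrq : r ^ q = 1 - ‖P (x - y)‖ ^ q := Real.rpow_inv_rpow (by linarith) hq.ne'
  set g : LinearMap.ker P := ⟨_, hker (x - y)⟩ with hg
  set c : LinearMap.ker P := ⟨_, hker (F x - F y)⟩ - A g with hc
  have key : ∀ h : LinearMap.ker P, ‖h‖ = r →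
      ‖A h + c‖ ^ q = 1 - ‖P (F x - F y)‖ ^ q := by
    intro h hh
    have hmem : x + (h - g : LinearMap.ker P) ∈ S := hS.add_mem _ hx _ (h - g).2
    have hdiff : x + (h - g : LinearMap.ker P) - y = h + P (x - y) := by
      rw [Submodule.coe_sub, hg]; dsimp only; abel
    have hPh : P (h + P (x - y)) = P (x - y) := by
      rw [map_add, hPP, LinearMap.mem_ker.1 h.2, zero_add]
    have hdist : dist (x + (h - g : LinearMap.ker P)) y = 1 := by
      rw [dist_eq_norm, hdiff]
      refine hinj (norm_nonneg _) zero_le_one ?_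
      rw [hnorm, hPh, add_sub_cancel_right, ← Submodule.coe_norm, hh, hrq, Real.one_rpow]
      ring
    rw [← hF.dist_eq_one_iff _ hmem _ hy, hA _ hx, dist_eq_norm] at hdist
    have hPD : P (F x + (A (h - g) : LinearMap.ker P) - F y) = P (F x - F y) := by
      rw [map_sub, map_add, LinearMap.mem_ker.1 (A (h - g)).2, add_zero, map_sub]
    have hD : F x + (A (h - g) : LinearMap.ker P) - F y - P (F x - F y) =
        (A h + c : LinearMap.ker P) := by
      rw [hc, map_sub]
      push_cast
      abel
    have h1 := hnorm (F x + (A (h - g) : LinearMap.ker P) - F y)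
    rw [hdist, hPD, hD, Real.one_rpow, ← Submodule.coe_norm] at h1
    linarith
  obtain ⟨c', hc'⟩ := (LinearMap.injective_iff_surjective (f := A.toLinearMap)).1 A.injective c
  have key' : ∀ h : LinearMap.ker P, ‖h‖ = r → ‖h + c'‖ ^ q = 1 - ‖P (F x - F y)‖ ^ q := by
    intro h hh
    rw [← key h hh, ← hc', LinearIsometry.coe_toLinearMap, ← map_add, A.norm_map]
  have hc0 : c' = 0 := eq_zero_of_norm_add_eq_norm_sub hr0 fun h hh =>
    hinj (norm_nonneg _) (norm_nonneg _)
      ((key' h hh).trans (key' (-h) (by rw [norm_neg, hh])).symm)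
  have : Nontrivial (LinearMap.ker P) := rank_pos_iff_nontrivial.1 (zero_lt_one.trans hP)
  obtain ⟨h, hh⟩ := NormedSpace.sphere_nonempty (x := (0 : LinearMap.ker P)).2 hr0.le
  rw [mem_sphere_zero_iff_norm] at hh
  have h1 := key' h hh
  rw [hc0, add_zero, hh, hrq] at h1
  exact hinj (norm_nonneg _) (norm_nonneg _) (by linarith)

theorem IsUnitDistanceBijOn.norm_map_sub_le (hF : IsUnitDistanceBijOn F S T)
    (hS : IsSlab P S) (hT : IsSlab P T) (hP : 1 < Module.rank ℝ (LinearMap.ker P))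
    (hPP : ∀ x, P (P x) = P x) {q : ℝ} (hq : 0 < q)
    (hnorm : ∀ x, ‖x‖ ^ q = ‖x - P x‖ ^ q + ‖P x‖ ^ q) {x y : E} (hx : x ∈ S) (hy : y ∈ S) :
    ‖P (F x - F y)‖ ≤ ‖P (x - y)‖ := by
  have := hS.convex.dist_le_norm_of_forall_dist_le P (fun x => P (F x)) one_pos ?_ hx hy
  · rwa [dist_eq_norm, ← map_sub] at this
  · intro x hx y hy hxy
    have hle : ‖P (x - y)‖ ≤ ‖x - y‖ := by
      rw [← Real.rpow_le_rpow_iff (norm_nonneg _) (norm_nonneg _) hq, hnorm (x - y)]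
      exact le_add_of_nonneg_left (by positivity)
    rw [dist_eq_norm] at hxy ⊢
    rw [← map_sub]
    exact (hF.norm_map_sub_eq hS hT hP hPP hq hnorm hx hy (hle.trans_lt hxy)).le

end Slab

/-! ### The `ℓ_p` norm and layers -/

section Layer

theorem PiLp.norm_rpow_eq_sum {ι : Type*} [Fintype ι] {p : ℝ≥0∞} [Fact (1 ≤ p)] (hp_top : p < ∞)
    (x : PiLp p fun _ : ι => ℝ) : ‖x‖ ^ p.toReal = ∑ i, |x i| ^ p.toReal := by
  have hq0 : 0 < p.toReal :=
    ENNReal.toReal_pos (zero_lt_one.trans_le Fact.out).ne' hp_top.ne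
  rw [PiLp.norm_eq_sum hq0, ← Real.rpow_mul (Finset.sum_nonneg fun i _ => by positivity),
    one_div_mul_cancel hq0.ne', Real.rpow_one]
  rfl

/-- The `ℓ_p` norm is strictly convex for `1 < p < ∞`, because `|·| ^ p` is strictly convex. -/
theorem PiLp.strictConvexSpace {ι : Type*} [Fintype ι] {p : ℝ≥0∞} [Fact (1 ≤ p)]
    (hp_one : 1 < p) (hp_top : p < ∞) : StrictConvexSpace ℝ (PiLp p fun _ : ι => ℝ) := by
  have hq : 1 < p.toReal := by
    rw [← ENNReal.toReal_one]
    exact (ENNReal.toReal_lt_toReal ENNReal.one_ne_top hp_top.ne).2 hp_one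
  have hq0 : 0 < p.toReal := one_pos.trans hq
  have hpow : ∀ x : PiLp p fun _ : ι => ℝ, ‖x‖ ^ p.toReal = ∑ i, |x i| ^ p.toReal :=
    PiLp.norm_rpow_eq_sum hp_top
  have hmono : ∀ a b : ℝ, |(a + b) / 2| ^ p.toReal ≤ ((|a| + |b|) / 2) ^ p.toReal := by
    intro a b
    refine Real.rpow_le_rpow (abs_nonneg _) ?_ hq0.le
    rw [abs_div, abs_two]
    linarith [abs_add_le a b]
  have hle : ∀ a b : ℝ, |(a + b) / 2| ^ p.toReal ≤ (|a| ^ p.toReal + |b| ^ p.toReal) / 2 := by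
    intro a b
    refine (hmono a b).trans ?_
    have := (strictConvexOn_rpow hq).convexOn.2 (abs_nonneg a) (abs_nonneg b)
      (by norm_num : (0 : ℝ) ≤ 1 / 2) (by norm_num : (0 : ℝ) ≤ 1 / 2) (by norm_num)
    simp only [smul_eq_mul] at this
    convert this using 1 <;> ring_nf
  have hlt : ∀ a b : ℝ, a ≠ b →
      |(a + b) / 2| ^ p.toReal < (|a| ^ p.toReal + |b| ^ p.toReal) / 2 := by
    intro a b hab
    by_cases habs : |a| = |b|
    · have hb : a = -b := (abs_eq_abs.1 habs).resolve_left hab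
      have hb0 : b ≠ 0 := by rintro rfl; exact hab (by simpa using hb)
      subst hb
      rw [abs_neg, neg_add_cancel, zero_div, abs_zero, Real.zero_rpow hq0.ne']
      positivity
    · refine (hmono a b).trans_lt ?_
      have := (strictConvexOn_rpow hq).2 (abs_nonneg a) (abs_nonneg b) habs
        (by norm_num : (0 : ℝ) < 1 / 2) (by norm_num : (0 : ℝ) < 1 / 2) (by norm_num)
      simp only [smul_eq_mul] at this
      convert this using 1 <;> ring_nf
  refine StrictConvexSpace.of_norm_add_ne_two fun x y hx hy hne hxy => ?_
  obtain ⟨i, hi⟩ : ∃ i, x i ≠ y i := by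
    by_contra! h
    exact hne (PiLp.ext h)
  have hhalf : ‖(1 / 2 : ℝ) • (x + y)‖ = 1 := by
    rw [norm_smul, hxy]; norm_num
  have hsum : ∑ i, |(x i + y i) / 2| ^ p.toReal <
      ∑ i, (|x i| ^ p.toReal + |y i| ^ p.toReal) / 2 :=
    Finset.sum_lt_sum (fun i _ => hle _ _) ⟨i, Finset.mem_univ _, hlt _ _ hi⟩
  rw [← Finset.sum_div, Finset.sum_add_distrib, ← hpow, ← hpow, hx, hy] at hsum
  have h1 := hpow ((1 / 2 : ℝ) • (x + y))
  rw [hhalf] at h1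
  have h2 : ∀ i, ((1 / 2 : ℝ) • (x + y)) i = (x i + y i) / 2 := by
    intro i
    simp only [PiLp.smul_apply, PiLp.add_apply, smul_eq_mul]
    ring
  simp only [h2, Real.one_rpow] at h1 hsum
  linarith

variable {n m : ℕ} {p : ℝ≥0∞}

/-- The projection of `ℝⁿ⁺ᵐ` onto its last `m` coordinates, as an endomorphism. -/
def verticalProj (n m : ℕ) (p : ℝ≥0∞) :
    PiLp p (fun _ : Fin n ⊕ Fin m => ℝ) →ₗ[ℝ] PiLp p (fun _ : Fin n ⊕ Fin m => ℝ) where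
  toFun x := WithLp.toLp p (Sum.elim (fun _ => 0) fun j => x (Sum.inr j))
  map_add' x y := by ext i; rcases i with i | i <;> simp
  map_smul' a x := by ext i; rcases i with i | i <;> simp

@[simp]
theorem verticalProj_inl (x : PiLp p (fun _ : Fin n ⊕ Fin m => ℝ)) (i : Fin n) :
    verticalProj n m p x (Sum.inl i) = 0 := rfl

@[simp]
theorem verticalProj_inr (x : PiLp p (fun _ : Fin n ⊕ Fin m => ℝ)) (j : Fin m) :
    verticalProj n m p x (Sum.inr j) = x (Sum.inr j) := rfl

theorem verticalProj_verticalProj (x : PiLp p (fun _ : Fin n ⊕ Fin m => ℝ)) :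
    verticalProj n m p (verticalProj n m p x) = verticalProj n m p x := by
  ext i; rcases i with i | i <;> simp

theorem mem_ker_verticalProj {x : PiLp p (fun _ : Fin n ⊕ Fin m => ℝ)} :
    x ∈ LinearMap.ker (verticalProj n m p) ↔ ∀ j, x (Sum.inr j) = 0 := by
  rw [LinearMap.mem_ker]
  constructor
  · intro h j
    rw [← verticalProj_inr, h, PiLp.zero_apply]
  · intro h
    ext i; rcases i with i | i <;> simp [h]

theorem one_lt_rank_ker_verticalProj (hn : 2 ≤ n) :
    1 < Module.rank ℝ (LinearMap.ker (verticalProj n m p)) := by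
  let i : (Fin n → ℝ) →ₗ[ℝ] LinearMap.ker (verticalProj n m p) :=
    LinearMap.codRestrict _
      { toFun := fun x => WithLp.toLp p (Sum.elim x fun _ => 0)
        map_add' := fun x y => by ext i; rcases i with i | i <;> simp
        map_smul' := fun a x => by ext i; rcases i with i | i <;> simp }
      fun x => mem_ker_verticalProj.2 fun j => rfl
  have hi : Function.Injective i := by
    intro x y hxy
    ext k
    exact congrArg (fun z : LinearMap.ker (verticalProj n m p) => z.1 (Sum.inl k)) hxy
  have h := LinearMap.rank_le_of_injective i hi
  rw [rank_fin_fun] at h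
  refine lt_of_lt_of_le ?_ h
  exact_mod_cast hn

variable [Fact (1 ≤ p)]

theorem norm_rpow_eq_verticalProj (hp_top : p < ∞) (x : PiLp p (fun _ : Fin n ⊕ Fin m => ℝ)) :
    ‖x‖ ^ p.toReal =
      ‖x - verticalProj n m p x‖ ^ p.toReal + ‖verticalProj n m p x‖ ^ p.toReal := by
  have hq0 : 0 < p.toReal :=
    ENNReal.toReal_pos (zero_lt_one.trans_le Fact.out).ne' hp_top.ne
  simp [PiLp.norm_rpow_eq_sum hp_top, Fintype.sum_sum_type, Real.zero_rpow hq0.ne']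

theorem norm_verticalProj_le (hp_top : p < ∞) {ε : ℝ} (hε : 0 ≤ ε)
    {x : PiLp p (fun _ : Fin n ⊕ Fin m => ℝ)} (h : ∀ j, |x (Sum.inr j)| ≤ ε) :
    ‖verticalProj n m p x‖ ≤ ε * ‖verticalProj n m p (WithLp.toLp p fun _ => 1)‖ := by
  have hq0 : 0 < p.toReal :=
    ENNReal.toReal_pos (zero_lt_one.trans_le Fact.out).ne' hp_top.ne
  rw [← Real.norm_of_nonneg hε, ← norm_smul,
    ← Real.rpow_le_rpow_iff (norm_nonneg _) (norm_nonneg _) hq0, PiLp.norm_rpow_eq_sum hp_top,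
    PiLp.norm_rpow_eq_sum hp_top]
  refine Finset.sum_le_sum fun i _ => Real.rpow_le_rpow (abs_nonneg _) ?_ hq0.le
  rcases i with i | j
  · simp
  · simpa [abs_of_nonneg hε] using h j

theorem isSlab_layer (hp_top : p < ∞) {ε : ℝ} (hε : 0 ≤ ε) :
    IsSlab (verticalProj n m p) (layer n m p ε) where
  convex x hx y hy a b ha hb hab j := by
    simpa using convex_Icc 0 ε (hx j) (hy j) ha hb hab
  add_mem x hx h hh j := by
    rw [PiLp.add_apply, mem_ker_verticalProj.1 hh j, add_zero]
    exact hx j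
  bounded := ⟨_, fun x hx => norm_verticalProj_le hp_top hε fun j => by
    rw [abs_of_nonneg (hx j).1]
    exact (hx j).2⟩

/-- The vertical part of a unit distance isomorphism of layers is Lipschitz with constant `1` and
onto, so it does not increase the vertical diameter, which is `ε` times a positive constant. -/
theorem le_of_unitDistanceGraph_layer_iso (hn : 2 ≤ n) (hm : 1 ≤ m) (hp_one : 1 < p)
    (hp_top : p < ∞) {ε₁ ε₂ : ℝ} (hε₁ : 0 ≤ ε₁) (hε₂ : 0 ≤ ε₂)
    (f : unitDistanceGraph (layer n m p ε₁) ≃g unitDistanceGraph (layer n m p ε₂)) :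
    ε₂ ≤ ε₁ := by
  classical
  have hstrict : StrictConvexSpace ℝ (PiLp p (fun _ : Fin n ⊕ Fin m => ℝ)) :=
    PiLp.strictConvexSpace hp_one hp_top
  have hq0 : 0 < p.toReal :=
    ENNReal.toReal_pos (zero_lt_one.trans_le Fact.out).ne' hp_top.ne
  let F : PiLp p (fun _ : Fin n ⊕ Fin m => ℝ) → PiLp p (fun _ : Fin n ⊕ Fin m => ℝ) :=
    fun x => if hx : x ∈ layer n m p ε₁ then f ⟨x, hx⟩ else x
  have hFf : ∀ x (hx : x ∈ layer n m p ε₁), F x = f ⟨x, hx⟩ := fun x hx => dif_pos hx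
  have hF : IsUnitDistanceBijOn F (layer n m p ε₁) (layer n m p ε₂) := by
    refine ⟨⟨fun x hx => ?_, fun x hx y hy hxy => ?_, fun y hy => ?_⟩, fun x hx y hy => ?_⟩
    · rw [hFf x hx]
      exact (f _).2
    · rw [hFf x hx, hFf y hy] at hxy
      exact congrArg Subtype.val (f.injective (Subtype.ext hxy))
    · obtain ⟨x, hx⟩ := f.surjective ⟨y, hy⟩
      exact ⟨x, x.2, by rw [hFf x x.2, Subtype.coe_eta, hx]⟩
    · rw [hFf x hx, hFf y hy]
      exact f.map_adj_iff (v := ⟨x, hx⟩) (w := ⟨y, hy⟩)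
  set o : PiLp p (fun _ : Fin n ⊕ Fin m => ℝ) := WithLp.toLp p fun _ => 1 with ho
  have ho0 : 0 < ‖verticalProj n m p o‖ := by
    refine norm_pos_iff.2 fun h => ?_
    have h1 := congrArg (fun z => z (Sum.inr ⟨0, hm⟩)) h
    simp [ho] at h1
  -- The two opposite corners `0` and `ε₂ • o` realize the vertical diameter of the second layer.
  obtain ⟨x, hx, hFx⟩ := hF.bijOn.surjOn (show ε₂ • o ∈ layer n m p ε₂ from fun j => by
    simp [ho, hε₂])
  obtain ⟨y, hy, hFy⟩ := hF.bijOn.surjOn (show 0 ∈ layer n m p ε₂ from fun j => by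
    simp [hε₂])
  have h1 := hF.norm_map_sub_le (isSlab_layer hp_top hε₁) (isSlab_layer hp_top hε₂)
    (one_lt_rank_ker_verticalProj hn) verticalProj_verticalProj hq0
    (norm_rpow_eq_verticalProj hp_top) hx hy
  have h2 := norm_verticalProj_le (x := x - y) hp_top hε₁ fun j => by
    have hxj := hx j
    have hyj := hy j
    rw [PiLp.sub_apply, abs_le]
    exact ⟨by linarith [hxj.1, hyj.2], by linarith [hxj.2, hyj.1]⟩
  rw [hFx, hFy, sub_zero, map_smul, norm_smul, Real.norm_of_nonneg hε₂] at h1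
  exact le_of_mul_le_mul_right (h1.trans h2) ho0

end Layer

theorem theorem2 (n m : ℕ) (hn : 2 ≤ n) (hm : 1 ≤ m)
    (p : ℝ≥0∞) [Fact (1 ≤ p)] (hp_one : 1 < p) (hp_top : p < ∞)
    (ε₁ ε₂ : ℝ) (hε₁ : 0 < ε₁) (hε₂ : 0 < ε₂) :
    Nonempty (unitDistanceGraph (layer n m p ε₁) ≃g unitDistanceGraph (layer n m p ε₂)) ↔
      ε₁ = ε₂ := by
  constructor
  · rintro ⟨f⟩
    exact le_antisymm (le_of_unitDistanceGraph_layer_iso hn hm hp_one hp_top hε₂.le hε₁.le f.symm)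
      (le_of_unitDistanceGraph_layer_iso hn hm hp_one hp_top hε₁.le hε₂.le f)
  · rintro rfl
    exact ⟨SimpleGraph.Iso.refl⟩
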